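/- Let $\mathsf{X}$ be a category with a zero object. A \emph{normal monomorphism} (resp. \emph{normal epimorphism}) in $\mathsf{X}$ is a morphism that is a kernel (resp. cokernel) of some morphism. A morphism $f$ is called \emph{normal} if $f = m e$ with $e$ a normal epimorphism and $m$ a normal monomorphism, and \emph{antinormal} if $f = e m$ with $m$ a normal monomorphism and $e$ a normal epimorphism. The category $\mathsf{X}$ is \emph{z-exact} if it has a zero object and every morphism has a kernel and a cokernel; it is \emph{di-exact} if it is z-exact and every antinormal morphism is normal. A \emph{short exact sequence} is a pair of morphisms $X \xrightarrow{k} Y \xrightarrow{q} Z$ such that $k$ is a kernel of $q$ and $q$ is a cokernel of $k$; the category $\mathsf{ses}(\mathsf{X})$ has the short exact sequences in $\mathsf{X}$ as objects and the triples of morphisms making both squares commute as morphisms. For an object $X$ of a z-exact category $\mathsf{X}$, $\mathsf{Nsub}(X)$ denotes the set of normal subobjects of $X$, i.e. isomorphism classes over $X$ of normal monomorphisms with target $X$, ordered by factorization over $X$; it is a lattice, in which $Y \wedge Z$ is represented by the pullback of $Y$ and $Z$ over $X$, and $Y \vee Z$ is represented by the kernel of the composite $X \to X/Z \to \operatorname{Coker}(Y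 \to X/Z)$. \textbf{Theorem.} Let $\mathsf{X}$ be a di-exact category. Then $\mathsf{ses}(\mathsf{X})$ is di-exact if and only if, for every object $X$ of $\mathsf{X}$, the lattice $\mathsf{Nsub}(X)$ is distributive, i.e. $U \wedge (V \vee W) = (U \wedge V) \vee (U \wedge W)$ for all $U, V, W \in \mathsf{Nsub}(X)$. -/

import Mathlib

open CategoryTheory CategoryTheory.Limits

universe v u

namespace ZExact

section Basic

variable {C : Type u} [Category.{v} C] [HasZeroMorphisms C]

/-- A morphism is a normal monomorphism if it is a kernel of some morphism. -/
def IsNormalMono {X Y : C} (f : X ⟶ Y) : Prop := Nonempty (NormalMono f)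

/-- A morphism is a normal epimorphism if it is a cokernel of some morphism. -/
def IsNormalEpi {X Y : C} (f : X ⟶ Y) : Prop := Nonempty (NormalEpi f)

/-- A normal (or proper) map: a normal epimorphism followed by a normal monomorphism. -/
def IsNormalMap {X Y : C} (f : X ⟶ Y) : Prop :=
  ∃ (I : C) (e : X ⟶ I) (m : I ⟶ Y), IsNormalEpi e ∧ IsNormalMono m ∧ e ≫ m = f

/-- An antinormal map: a normal monomorphism followed by a normal epimorphism. -/
def IsAntinormalMap {X Y : C} (f : X ⟶ Y) : Prop :=
  ∃ (A : C) (m : X ⟶ A) (e : A ⟶ Y), IsNormalMono m ∧ IsNormalEpi e ∧ m ≫ e = f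

end Basic

/-- A z-exact category: a pointed category with all kernels and cokernels.
(In a category with a zero object the zero morphisms are uniquely determined.) -/
class IsZExact (C : Type u) [Category.{v} C] [HasZeroMorphisms C] : Prop
    extends HasZeroObject C, HasKernels C, HasCokernels C

/-- A di-exact category: a z-exact category in which every antinormal map is normal. -/
class IsDiExact (C : Type u) [Category.{v} C] [HasZeroMorphisms C] : Prop
    extends IsZExact C where
  isNormalMap_of_isAntinormalMap : ∀ {X Y : C} (f : X ⟶ Y), IsAntinormalMap f → IsNormalMap f

section ShortExactSequences

variable {C : Type u} [Category.{v} C] [HasZeroMorphisms C]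

/-- `X ⟶ Y ⟶ Z` is a short exact sequence if the first morphism is a kernel of the second
and the second is a cokernel of the first. -/
def isShortExact (C : Type u) [Category.{v} C] [HasZeroMorphisms C] :
    ObjectProperty (ShortComplex C) := fun S =>
  Nonempty (IsLimit (KernelFork.ofι S.f S.zero)) ∧
    Nonempty (IsColimit (CokernelCofork.ofπ S.g S.zero))

/-- The category of short exact sequences in `C`; the morphisms are the triples of morphisms
of `C` that make both squares commute. -/
abbrev SES (C : Type u) [Category.{v} C] [HasZeroMorphisms C] : Type (max u v) :=
  (isShortExact C).FullSubcategory

end ShortExactSequences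

section NormalSubobjects

variable {C : Type u} [Category.{v} C] [HasZeroMorphisms C]

/-- Normal subobjects of `X`: isomorphism classes of normal monomorphisms with target `X`. -/
@[ext]
structure NSub (X : C) : Type (max u v) where
  /-- the underlying subobject, an isomorphism class of monomorphisms -/
  sub : Subobject X
  isNormalMono : IsNormalMono sub.arrow

/-- Normal subobjects are ordered by inclusion, that is, by factorization over `X`. -/
instance (X : C) : PartialOrder (NSub X) :=
  PartialOrder.lift NSub.sub (fun _ _ => NSub.ext)

theorem isNormalMono_kernel_ι {X Y : C} (f : X ⟶ Y) [HasKernel f] :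
    IsNormalMono (kernel.ι f) :=
  ⟨{ Z := Y, g := f, w := kernel.condition f, isLimit := kernelIsKernel f }⟩

/-- The normal subobject represented by a normal monomorphism. -/
noncomputable def NSub.ofι {A X : C} (f : A ⟶ X) [Mono f] (hf : IsNormalMono f) : NSub X :=
  ⟨Subobject.mk f, by
    obtain ⟨h⟩ := hf
    have hw : (Subobject.mk f).arrow ≫ h.g = 0 := by
      rw [← Subobject.underlyingIso_hom_comp_eq_mk, Category.assoc, h.w, comp_zero]
    exact ⟨{
      Z := h.Z
      g := h.g
      w := hw
      isLimit := IsKernel.isoKernel h.g (Subobject.mk f).arrow h.isLimit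
        (Subobject.underlyingIso f) (Subobject.underlyingIso_hom_comp_eq_mk f) }⟩⟩

variable [HasCokernels C]

/-- A normal monomorphism is a kernel of its cokernel. -/
theorem IsNormalMono.exists_lift {A X : C} {m : A ⟶ X} (hm : IsNormalMono m) {T : C}
    (t : T ⟶ X) (ht : t ≫ cokernel.π m = 0) : ∃ s : T ⟶ A, s ≫ m = t := by
  obtain ⟨h⟩ := hm
  have : t ≫ h.g = 0 := by
    rw [← cokernel.π_desc m h.g h.w, reassoc_of% ht, zero_comp]
  exact ⟨h.isLimit.lift (KernelFork.ofι t this), h.isLimit.fac _ WalkingParallelPair.zero⟩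

/-- A monomorphism with the lifting property of the kernel of its cokernel is normal. -/
theorem isNormalMono_of_exists_lift {A X : C} (m : A ⟶ X) [Mono m]
    (h : ∀ {T : C} (t : T ⟶ X), t ≫ cokernel.π m = 0 → ∃ s : T ⟶ A, s ≫ m = t) :
    IsNormalMono m :=
  ⟨{ Z := cokernel m
     g := cokernel.π m
     w := cokernel.condition m
     isLimit := KernelFork.IsLimit.ofι _ _ (fun t ht => (h t ht).choose)
      (fun t ht => (h t ht).choose_spec)
      (fun t ht _ hs => (cancel_mono m).1 (hs.trans (h t ht).choose_spec.symm)) }⟩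

/-- The quotient `X ⟶ X/Z ⟶ Coker (Y ⟶ X/Z)`. -/
noncomputable def unionπ {X Y Z : C} (y : Y ⟶ X) (z : Z ⟶ X) :
    X ⟶ cokernel (y ≫ cokernel.π z) :=
  cokernel.π z ≫ cokernel.π (y ≫ cokernel.π z)

theorem comp_unionπ_left {X Y Z : C} (y : Y ⟶ X) (z : Z ⟶ X) : y ≫ unionπ y z = 0 := by
  rw [unionπ, ← Category.assoc, cokernel.condition]

theorem comp_unionπ_right {X Y Z : C} (y : Y ⟶ X) (z : Z ⟶ X) : z ≫ unionπ y z = 0 := by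
  rw [unionπ, ← Category.assoc, cokernel.condition, zero_comp]

variable [HasKernels C]

/-- The pullback of two monomorphisms `y`, `z` into `X`, with `z` normal, as a morphism to `X`:
it is the kernel of `Y ⟶ X ⟶ X/Z` followed by `y`. -/
noncomputable def interι {X Y Z : C} (y : Y ⟶ X) (z : Z ⟶ X) :
    kernel (y ≫ cokernel.π z) ⟶ X :=
  kernel.ι (y ≫ cokernel.π z) ≫ y

instance {X Y Z : C} (y : Y ⟶ X) (z : Z ⟶ X) [Mono y] : Mono (interι y z) := by
  unfold interι; infer_instance

theorem exists_interι_lift {X Y Z T : C} (y : Y ⟶ X) {z : Z ⟶ X}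
    (a : T ⟶ Y) (b : T ⟶ Z) (h : a ≫ y = b ≫ z) : ∃ s, s ≫ interι y z = a ≫ y := by
  refine ⟨kernel.lift _ a ?_, ?_⟩
  · rw [reassoc_of% h, cokernel.condition, comp_zero]
  · rw [interι, kernel.lift_ι_assoc]

theorem exists_interι_snd {X Y Z : C} (y : Y ⟶ X) {z : Z ⟶ X} (hz : IsNormalMono z) :
    ∃ b, b ≫ z = interι y z :=
  hz.exists_lift _ (by rw [interι, Category.assoc, kernel.condition])

theorem isNormalMono_interι {X Y Z : C} {y : Y ⟶ X} {z : Z ⟶ X} [Mono y]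
    (hy : IsNormalMono y) (hz : IsNormalMono z) : IsNormalMono (interι y z) := by
  refine isNormalMono_of_exists_lift _ fun {T} t ht => ?_
  obtain ⟨b, hb⟩ := exists_interι_snd y hz
  have h1 : interι y z ≫ cokernel.π y = 0 := by
    rw [interι, Category.assoc, cokernel.condition, comp_zero]
  have h2 : interι y z ≫ cokernel.π z = 0 := by
    rw [← hb, Category.assoc, cokernel.condition, comp_zero]
  obtain ⟨s, hs⟩ := hy.exists_lift t (by
    rw [← cokernel.π_desc _ _ h1, reassoc_of% ht, zero_comp])
  obtain ⟨r, hr⟩ := hz.exists_lift t (by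
    rw [← cokernel.π_desc _ _ h2, reassoc_of% ht, zero_comp])
  obtain ⟨q, hq⟩ := exists_interι_lift y s r (hs.trans hr.symm)
  exact ⟨q, hq.trans hs⟩

/-- `Y ∩ Z` is represented by the pullback of `Y` and `Z`; `Y ∪ Z` is represented by the kernel
of the quotient `X ⟶ X/Z ⟶ Coker (Y ⟶ X/Z)`. These are the product and the coproduct
(infimum and supremum) of `Y` and `Z` among the normal subobjects of `X`. -/
noncomputable instance (X : C) : Lattice (NSub X) where
  inf Y Z := NSub.ofι (interι Y.sub.arrow Z.sub.arrow) (isNormalMono_interι Y.isNormalMono Z.isNormalMono)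
  sup Y Z := NSub.ofι (kernel.ι (unionπ Y.sub.arrow Z.sub.arrow)) (isNormalMono_kernel_ι _)
  inf_le_left Y Z := Subobject.mk_le_of_comm (kernel.ι _) rfl
  inf_le_right Y Z :=
    Subobject.mk_le_of_comm _ (exists_interι_snd Y.sub.arrow Z.isNormalMono).choose_spec
  le_inf T Y Z hY hZ := by
    obtain ⟨s, hs⟩ := exists_interι_lift Y.sub.arrow (z := Z.sub.arrow)
      (Subobject.ofLE T.sub Y.sub hY) (Subobject.ofLE T.sub Z.sub hZ) (by simp)
    exact Subobject.le_mk_of_comm s (hs.trans (Subobject.ofLE_arrow hY))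
  le_sup_left Y Z :=
    Subobject.le_mk_of_comm (kernel.lift _ _ (comp_unionπ_left _ _)) (kernel.lift_ι _ _ _)
  le_sup_right Y Z :=
    Subobject.le_mk_of_comm (kernel.lift _ _ (comp_unionπ_right _ _)) (kernel.lift_ι _ _ _)
  sup_le Y Z T hY hZ := by
    have h1 : Z.sub.arrow ≫ cokernel.π T.sub.arrow = 0 := by
      rw [← Subobject.ofLE_arrow (show Z.sub ≤ T.sub from hZ), Category.assoc, cokernel.condition,
        comp_zero]
    have h2 : (Y.sub.arrow ≫ cokernel.π Z.sub.arrow) ≫ cokernel.desc _ _ h1 = 0 := by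
      rw [Category.assoc, cokernel.π_desc,
        ← Subobject.ofLE_arrow (show Y.sub ≤ T.sub from hY), Category.assoc, cokernel.condition,
        comp_zero]
    have h3 : unionπ Y.sub.arrow Z.sub.arrow ≫ cokernel.desc _ _ h2 = cokernel.π T.sub.arrow := by
      rw [unionπ, Category.assoc, cokernel.π_desc, cokernel.π_desc]
    obtain ⟨s, hs⟩ := T.isNormalMono.exists_lift (kernel.ι (unionπ Y.sub.arrow Z.sub.arrow)) (by
      rw [← h3, ← Category.assoc, kernel.condition, zero_comp])
    exact Subobject.mk_le_of_comm s hs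

end NormalSubobjects

/-- A lattice is distributive if meets distribute over joins. -/
def IsDistributive (L : Type*) [Lattice L] : Prop :=
  ∀ x y z : L, x ⊓ (y ⊔ z) = (x ⊓ y) ⊔ (x ⊓ z)

end ZExact

/-! A morphism of short exact sequences is determined by its middle component. Kernels and cokernels
in `SES C` are computed there, completed by a left square that is a pullback, respectively a right
square that is a pushout. So an antinormal map `m ≫ e` amounts to a middle object A with three
normal subobjects: U from `m`, V from the middle sequence, and W = ker of the middle part of `e`.
Its domain is U ∧ V → U → U/(U ∧ V), and its codomain has middle term A/W and last term A/(V ∨ W).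

Di-exactness of `C` gives U → A/W a normal image I. A normal factorization in `SES C` must equip I
with one normal subobject that is both the kernel of I → A/(V ∨ W) and the one generated by U ∧ V.
Pulled back to U, these are U ∧ (V ∨ W) and the join of U ∧ V and U ∧ W, so normality is
distributivity at U, V, W (`SES.comp_eq_zero_of_isNormalMap`, `SES.isNormalMap_comp`). That join is
formed in U rather than in A; `comp_eq_zero_of_le_join` uses di-exactness to reconcile the two.
`MeetLeJoin` expresses the inclusion through test morphisms and links both sides of the equivalence.
-/

namespace ZExact

/-! ### Kernels and cokernels as propositions. -/

section KernelPairs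

variable {C : Type u} [Category.{v} C] [HasZeroMorphisms C]

/-- `k` is a kernel of `q`. -/
structure IsKer {K X Y : C} (k : K ⟶ X) (q : X ⟶ Y) : Prop where
  w : k ≫ q = 0
  mono : Mono k
  lift : ∀ {T : C} (t : T ⟶ X), t ≫ q = 0 → ∃ s, s ≫ k = t

/-- `q` is a cokernel of `k`. -/
structure IsCok {K X Y : C} (q : X ⟶ Y) (k : K ⟶ X) : Prop where
  w : k ≫ q = 0
  epi : Epi q
  desc : ∀ {T : C} (t : X ⟶ T), k ≫ t = 0 → ∃ s, q ≫ s = t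

theorem isKer_of_isLimit {K X Y : C} {k : K ⟶ X} {q : X ⟶ Y} {w : k ≫ q = 0}
    (h : IsLimit (KernelFork.ofι k w)) : IsKer k q where
  w := w
  mono := ⟨fun _ _ e => Fork.IsLimit.hom_ext h e⟩
  lift t ht := ⟨h.lift (KernelFork.ofι t ht), h.fac _ WalkingParallelPair.zero⟩

theorem isCok_of_isColimit {K X Y : C} {k : K ⟶ X} {q : X ⟶ Y} {w : k ≫ q = 0}
    (h : IsColimit (CokernelCofork.ofπ q w)) : IsCok q k where
  w := w
  epi := ⟨fun _ _ e => Cofork.IsColimit.hom_ext h e⟩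
  desc t ht := ⟨h.desc (CokernelCofork.ofπ t ht), h.fac _ WalkingParallelPair.one⟩

theorem IsKer.nonempty_isLimit {K X Y : C} {k : K ⟶ X} {q : X ⟶ Y} (h : IsKer k q) :
    Nonempty (IsLimit (KernelFork.ofι k h.w)) :=
  haveI := h.mono
  ⟨KernelFork.IsLimit.ofι _ _ (fun t ht => (h.lift t ht).choose)
    (fun t ht => (h.lift t ht).choose_spec)
    (fun t ht _ hs => (cancel_mono k).1 (hs.trans (h.lift t ht).choose_spec.symm))⟩

theorem IsCok.nonempty_isColimit {K X Y : C} {k : K ⟶ X} {q : X ⟶ Y} (h : IsCok q k) :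
    Nonempty (IsColimit (CokernelCofork.ofπ q h.w)) :=
  haveI := h.epi
  ⟨CokernelCofork.IsColimit.ofπ _ _ (fun t ht => (h.desc t ht).choose)
    (fun t ht => (h.desc t ht).choose_spec)
    (fun t ht _ hs => (cancel_epi q).1 (hs.trans (h.desc t ht).choose_spec.symm))⟩

theorem IsKer.isNormalMono {K X Y : C} {k : K ⟶ X} {q : X ⟶ Y} (h : IsKer k q) :
    IsNormalMono k :=
  ⟨{ Z := Y, g := q, w := h.w, isLimit := h.nonempty_isLimit.some }⟩

theorem IsCok.isNormalEpi {K X Y : C} {k : K ⟶ X} {q : X ⟶ Y} (h : IsCok q k) :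
    IsNormalEpi q :=
  ⟨{ W := K, g := k, w := h.w, isColimit := h.nonempty_isColimit.some }⟩

theorem IsNormalMono.exists_isKer {K X : C} {k : K ⟶ X} (h : IsNormalMono k) :
    ∃ (Y : C) (q : X ⟶ Y), IsKer k q :=
  let ⟨n⟩ := h
  ⟨n.Z, n.g, isKer_of_isLimit n.isLimit⟩

theorem IsNormalEpi.exists_isCok {X Y : C} {q : X ⟶ Y} (h : IsNormalEpi q) :
    ∃ (K : C) (k : K ⟶ X), IsCok q k :=
  let ⟨n⟩ := h
  ⟨n.W, n.g, isCok_of_isColimit n.isColimit⟩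

theorem IsNormalMono.mono {K X : C} {k : K ⟶ X} (h : IsNormalMono k) : Mono k :=
  let ⟨_, _, hk⟩ := h.exists_isKer
  hk.mono

theorem IsNormalEpi.epi {X Y : C} {q : X ⟶ Y} (h : IsNormalEpi q) : Epi q :=
  let ⟨_, _, hq⟩ := h.exists_isCok
  hq.epi

theorem isKer_kernel_ι {X Y : C} (q : X ⟶ Y) [HasKernel q] : IsKer (kernel.ι q) q :=
  isKer_of_isLimit (w := kernel.condition q) (kernelIsKernel q)

theorem isCok_cokernel_π {X Y : C} (k : X ⟶ Y) [HasCokernel k] : IsCok (cokernel.π k) k :=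
  isCok_of_isColimit (w := cokernel.condition k) (cokernelIsCokernel k)

/-- A normal monomorphism is a kernel of any of its cokernels. -/
theorem IsNormalMono.isKer {K X Y : C} {k : K ⟶ X} {q : X ⟶ Y} (hk : IsNormalMono k)
    (hq : IsCok q k) : IsKer k q := by
  obtain ⟨_, c, hc⟩ := hk.exists_isKer
  obtain ⟨d, rfl⟩ := hq.desc c hc.w
  exact ⟨hq.w, hc.mono, fun t ht => hc.lift t (by rw [reassoc_of% ht, zero_comp])⟩

/-- A normal epimorphism is a cokernel of any of its kernels. -/
theorem IsNormalEpi.isCok {K X Y : C} {k : K ⟶ X} {q : X ⟶ Y} (hq : IsNormalEpi q)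
    (hk : IsKer k q) : IsCok q k := by
  obtain ⟨_, c, hc⟩ := hq.exists_isCok
  obtain ⟨d, rfl⟩ := hk.lift c hc.w
  exact ⟨hk.w, hc.epi, fun t ht => hc.desc t (by rw [Category.assoc, ht, comp_zero])⟩

theorem IsKer.of_comp {K X Y Z : C} {k : K ⟶ X} {u : X ⟶ Y} {c : Y ⟶ Z} (hu : Mono u)
    (h : IsKer (k ≫ u) c) : IsKer k (u ≫ c) where
  w := by simpa using h.w
  mono := haveI := h.mono; mono_of_mono k u
  lift t ht := by
    obtain ⟨s, hs⟩ := h.lift (t ≫ u) (by simpa using ht)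
    exact ⟨s, (cancel_mono u).1 (by simpa using hs)⟩

theorem IsNormalEpi.exists_desc [HasKernels C] {X Y T : C} {q : X ⟶ Y} (hq : IsNormalEpi q)
    (t : X ⟶ T) (ht : ∀ {S : C} (s : S ⟶ X), s ≫ q = 0 → s ≫ t = 0) : ∃ r, q ≫ r = t :=
  (hq.isCok (isKer_kernel_ι q)).desc t (ht _ (kernel.condition q))

end KernelPairs

/-! ### Joins of normal subobjects and the test-morphism form of distributivity. -/

section Joins

variable {C : Type u} [Category.{v} C] [HasZeroMorphisms C]

/-- If `P` and `Q` are contained in a normal subobject `U` of `A` and are normal in `A`, then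
their join in `U` contains their join in `A`. -/
theorem comp_eq_zero_of_le_join [IsDiExact C] {A U P Q L S : C} {u : U ⟶ A}
    (hu : IsNormalMono u) {p : P ⟶ U} {q : Q ⟶ U} (hp : IsNormalMono (p ≫ u))
    (hq : IsNormalMono (q ≫ u)) {s : U ⟶ S} (hps : p ≫ s = 0) (hqs : q ≫ s = 0) {l : L ⟶ U}
    (hl : ∀ {T : C} (y : A ⟶ T), p ≫ u ≫ y = 0 → q ≫ u ≫ y = 0 → l ≫ u ≫ y = 0) :
    l ≫ s = 0 := by
  have hmu := hu.mono
  -- Work modulo Q: di-exactness makes U → A/Q factor through a normal subobject B of A/Q. The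
  -- kernel of `b` is Q, so `s` descends to B.
  have ha := isCok_cokernel_π (q ≫ u)
  have hka := hq.isKer ha
  generalize cokernel.π (q ≫ u) = a at ha hka
  obtain ⟨B, b, w, hb, hw, hbw⟩ := IsDiExact.isNormalMap_of_isAntinormalMap (u ≫ a)
    ⟨_, u, a, hu, ha.isNormalEpi, rfl⟩
  have hmw := hw.mono
  obtain ⟨s', rfl⟩ := hb.exists_desc s (fun t ht => by
    obtain ⟨r, hr⟩ := hka.lift (t ≫ u) (by
      rw [Category.assoc, ← hbw, reassoc_of% ht, zero_comp])
    obtain rfl : r ≫ q = t := (cancel_mono u).1 (by simpa using hr)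
    rw [Category.assoc, hqs, comp_zero])
  obtain ⟨_, c, hc⟩ := hp.exists_isKer
  -- P has a normal image `i'` in B and a normal image `i` in A/Q. The comparison `ψ` puts the
  -- latter inside the former, and `s'` kills `i'`.
  obtain ⟨I', p₁, i', hp₁, hi', hpi'⟩ := IsDiExact.isNormalMap_of_isAntinormalMap (p ≫ b)
    ⟨_, p, b, (hc.of_comp hmu).isNormalMono, hb, rfl⟩
  obtain ⟨I, p₂, i, hp₂, hi, hpi⟩ := IsDiExact.isNormalMap_of_isAntinormalMap ((p ≫ u) ≫ a)
    ⟨_, p ≫ u, a, hp, ha.isNormalEpi, rfl⟩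
  have hmi' := hi'.mono
  have hep₁ := hp₁.epi
  have hep₂ := hp₂.epi
  have key : p₁ ≫ i' ≫ w = p₂ ≫ i := by
    rw [reassoc_of% hpi', hbw, hpi, Category.assoc]
  obtain ⟨ψ, rfl⟩ := hp₂.exists_desc p₁ (fun t ht => by
    rw [← cancel_mono i', ← cancel_mono w]
    simp [key, reassoc_of% ht])
  have hψ : ψ ≫ i' ≫ w = i := (cancel_epi p₂).1 (by simpa using key)
  obtain ⟨l', hl'⟩ := hi.exists_lift (l ≫ u ≫ a) (by
    simpa using hl (a ≫ cokernel.π i)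
      (by rw [← Category.assoc u, ← Category.assoc p, ← Category.assoc p, ← hpi, Category.assoc,
        cokernel.condition, comp_zero])
      (by rw [← Category.assoc, ← Category.assoc, ha.w, zero_comp]))
  have hlb : l ≫ b = l' ≫ ψ ≫ i' := (cancel_mono w).1 (by
    rw [Category.assoc, hbw, ← hl', ← hψ]; simp)
  have hi's : i' ≫ s' = 0 := (cancel_epi (p₂ ≫ ψ)).1 (by
    rw [← Category.assoc, hpi', Category.assoc, hps, comp_zero])
  rw [reassoc_of% hlb, hi's, comp_zero, comp_zero]

/-- For normal subobjects `U`, `V`, `W` of an object, `U ∧ (V ∨ W)` is contained in the join of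
`U ∧ V` and `U ∧ W` in `U`: every morphism from `U` that kills both meets kills it. -/
def MeetLeJoin (C : Type u) [Category.{v} C] [HasZeroMorphisms C] : Prop :=
  ∀ ⦃A U V W S J : C⦄ (u : U ⟶ A) (v : V ⟶ A) (w : W ⟶ A) (s : U ⟶ S) (j : J ⟶ U),
    IsNormalMono u → IsNormalMono v → IsNormalMono w →
    (∀ ⦃T : C⦄ (t : T ⟶ U) (r : T ⟶ V), t ≫ u = r ≫ v → t ≫ s = 0) →
    (∀ ⦃T : C⦄ (t : T ⟶ U) (r : T ⟶ W), t ≫ u = r ≫ w → t ≫ s = 0) →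
    (∀ ⦃T : C⦄ (y : A ⟶ T), v ≫ y = 0 → w ≫ y = 0 → j ≫ u ≫ y = 0) → j ≫ s = 0

namespace NSub

variable {X : C}

theorem le_iff [HasCokernels C] {M N : NSub X} :
    M ≤ N ↔ M.sub.arrow ≫ cokernel.π N.sub.arrow = 0 := by
  refine ⟨fun h => ?_, fun h => ?_⟩
  · rw [← Subobject.ofLE_arrow (show M.sub ≤ N.sub from h), Category.assoc, cokernel.condition,
      comp_zero]
  · obtain ⟨s, hs⟩ := N.isNormalMono.exists_lift _ h
    exact Subobject.le_of_comm s hs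

theorem comp_eq_zero_of_le {M N : NSub X} (h : M ≤ N) {T : C} {y : X ⟶ T}
    (hy : N.sub.arrow ≫ y = 0) : M.sub.arrow ≫ y = 0 := by
  rw [← Subobject.ofLE_arrow (show M.sub ≤ N.sub from h), Category.assoc, hy, comp_zero]

theorem ofι_arrow_comp_eq_zero_iff {A T : C} (f : A ⟶ X) [Mono f] (hf : IsNormalMono f)
    (y : X ⟶ T) : (ofι f hf).sub.arrow ≫ y = 0 ↔ f ≫ y = 0 := by
  change (Subobject.mk f).arrow ≫ y = 0 ↔ _
  rw [← Subobject.underlyingIso_hom_comp_eq_mk, Category.assoc,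
    ← cancel_epi (Subobject.underlyingIso f).inv, Iso.inv_hom_id_assoc, comp_zero]

theorem exists_ofι_arrow {A : C} (f : A ⟶ X) [Mono f] (hf : IsNormalMono f) :
    ∃ r, r ≫ f = (ofι f hf).sub.arrow :=
  ⟨_, Subobject.underlyingIso_hom_comp_eq_mk f⟩

theorem exists_comp_ofι_arrow {A : C} (f : A ⟶ X) [Mono f] (hf : IsNormalMono f) :
    ∃ r, r ≫ (ofι f hf).sub.arrow = f :=
  ⟨_, Subobject.underlyingIso_arrow f⟩

variable [HasCokernels C] [HasKernels C]

theorem sup_arrow_comp_eq_zero {M N : NSub X} {T : C} {y : X ⟶ T} (hM : M.sub.arrow ≫ y = 0)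
    (hN : N.sub.arrow ≫ y = 0) : (M ⊔ N).sub.arrow ≫ y = 0 := by
  have h : M ⊔ N ≤ ofι (kernel.ι y) (isNormalMono_kernel_ι y) :=
    sup_le (Subobject.le_mk_of_comm _ (kernel.lift_ι y _ hM))
      (Subobject.le_mk_of_comm _ (kernel.lift_ι y _ hN))
  exact comp_eq_zero_of_le h ((ofι_arrow_comp_eq_zero_iff _ _ _).2 (kernel.condition y))

theorem exists_comp_inf_arrow {M N : NSub X} {T : C} {t : T ⟶ X}
    (hM : t ≫ cokernel.π M.sub.arrow = 0) (hN : t ≫ cokernel.π N.sub.arrow = 0) :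
    ∃ r, r ≫ (M ⊓ N).sub.arrow = t := by
  obtain ⟨a, ha⟩ := M.isNormalMono.exists_lift t hM
  obtain ⟨b, hb⟩ := N.isNormalMono.exists_lift t hN
  obtain ⟨s, hs⟩ := exists_interι_lift M.sub.arrow a b (ha.trans hb.symm)
  obtain ⟨r, hr⟩ := exists_comp_ofι_arrow (interι M.sub.arrow N.sub.arrow)
    (isNormalMono_interι M.isNormalMono N.isNormalMono)
  exact ⟨s ≫ r, by
    change (s ≫ r) ≫ (ofι (interι M.sub.arrow N.sub.arrow)
      (isNormalMono_interι M.isNormalMono N.isNormalMono)).sub.arrow = t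
    rw [Category.assoc, hr, hs, ha]⟩

end NSub

/-- Only one inclusion needs proof; test it with `s` the restriction to `x` of the quotient of `X`
by `(x ⊓ y) ⊔ (x ⊓ z)`. -/
theorem MeetLeJoin.isDistributive [IsZExact C] (h : MeetLeJoin C) (X : C) :
    IsDistributive (NSub X) := by
  intro x y z
  refine le_antisymm ?_ le_inf_sup
  have hx : x ⊓ (y ⊔ z) ≤ x := inf_le_left
  have hj := Subobject.ofLE_arrow (show (x ⊓ (y ⊔ z)).sub ≤ x.sub from hx)
  have aux : ∀ {y' : NSub X}, x ⊓ y' ≤ (x ⊓ y) ⊔ (x ⊓ z) → ∀ ⦃T : C⦄ (t : T ⟶ (x.sub : C))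
      (r : T ⟶ (y'.sub : C)), t ≫ x.sub.arrow = r ≫ y'.sub.arrow →
        t ≫ x.sub.arrow ≫ cokernel.π ((x ⊓ y) ⊔ (x ⊓ z)).sub.arrow = 0 := by
    intro y' hy' T t r htr
    obtain ⟨e, he⟩ := NSub.exists_comp_inf_arrow (M := x) (N := y') (t := t ≫ x.sub.arrow)
      (by rw [Category.assoc, cokernel.condition, comp_zero])
      (by rw [htr, Category.assoc, cokernel.condition, comp_zero])
    rw [← Category.assoc, ← he, Category.assoc, NSub.le_iff.1 hy', comp_zero]
  rw [NSub.le_iff, ← hj, Category.assoc]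
  refine h x.sub.arrow y.sub.arrow z.sub.arrow _ _ x.isNormalMono y.isNormalMono z.isNormalMono
    (aux le_sup_left) (aux le_sup_right) (fun T f hy hz => ?_)
  rw [← Category.assoc, hj]
  exact NSub.comp_eq_zero_of_le inf_le_right (NSub.sup_arrow_comp_eq_zero hy hz)

/-- Distributivity bounds `j` by a join formed in `A`, while `s` is defined only on `U`;
`comp_eq_zero_of_le_join` bridges this gap, whence di-exactness. -/
theorem meetLeJoin_of_isDistributive [IsDiExact C] (h : ∀ X : C, IsDistributive (NSub X)) :
    MeetLeJoin C := by
  intro A U V W S J u v w s j hu hv hw hsv hsw hj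
  have := hu.mono
  have := hv.mono
  have := hw.mono
  have hd := h A (.ofι u hu) (.ofι v hv) (.ofι w hw)
  have aux : ∀ {V' : C} (v' : V' ⟶ A) [Mono v'] (hv' : IsNormalMono v'),
      (∀ ⦃T : C⦄ (t : T ⟶ U) (r : T ⟶ V'), t ≫ u = r ≫ v' → t ≫ s = 0) →
      ∃ p, p ≫ u = (NSub.ofι u hu ⊓ NSub.ofι v' hv').sub.arrow ∧ p ≫ s = 0 := by
    intro V' v' _ hv' hs
    obtain ⟨a, ha⟩ := NSub.exists_ofι_arrow u hu
    obtain ⟨b, hb⟩ := NSub.exists_ofι_arrow v' hv'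
    have h1 : NSub.ofι u hu ⊓ NSub.ofι v' hv' ≤ _ := inf_le_left
    have h2 : NSub.ofι u hu ⊓ NSub.ofι v' hv' ≤ _ := inf_le_right
    have h1' := Subobject.ofLE_arrow (show (NSub.ofι u hu ⊓ NSub.ofι v' hv').sub ≤ _ from h1)
    have h2' := Subobject.ofLE_arrow (show (NSub.ofι u hu ⊓ NSub.ofι v' hv').sub ≤ _ from h2)
    rw [← ha, ← Category.assoc] at h1'
    rw [← hb, ← Category.assoc] at h2'
    exact ⟨_, h1', hs _ _ (h1'.trans h2'.symm)⟩
  obtain ⟨p, hp, hps⟩ := aux v hv hsv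
  obtain ⟨q, hq, hqs⟩ := aux w hw hsw
  refine comp_eq_zero_of_le_join hu (hp ▸ NSub.isNormalMono _) (hq ▸ NSub.isNormalMono _)
    hps hqs (fun y hpy hqy => ?_)
  obtain ⟨r, hr⟩ := NSub.exists_comp_inf_arrow (M := NSub.ofι u hu)
    (N := NSub.ofι v hv ⊔ NSub.ofι w hw) (t := j ≫ u)
    (by rw [Category.assoc, (NSub.ofι_arrow_comp_eq_zero_iff u hu _).1 (cokernel.condition _),
      comp_zero])
    (by
      rw [Category.assoc]
      exact hj _ ((NSub.ofι_arrow_comp_eq_zero_iff v hv _).1 (NSub.le_iff.1 le_sup_left))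
        ((NSub.ofι_arrow_comp_eq_zero_iff w hw _).1 (NSub.le_iff.1 le_sup_right)))
  rw [← Category.assoc, ← hr, Category.assoc, NSub.comp_eq_zero_of_le hd.le, comp_zero]
  refine NSub.sup_arrow_comp_eq_zero ?_ ?_
  · rw [← hp, Category.assoc, hpy]
  · rw [← hq, Category.assoc, hqy]

end Joins

/-! ### Short exact sequences and their middle components. -/

namespace SES

variable {C : Type u} [Category.{v} C] [HasZeroMorphisms C]

theorem isKer (X : SES C) : IsKer X.obj.f X.obj.g :=
  isKer_of_isLimit X.property.1.some

theorem isCok (X : SES C) : IsCok X.obj.g X.obj.f :=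
  isCok_of_isColimit X.property.2.some

/-- The short exact sequence given by a kernel and its cokernel. -/
abbrev ofIsKerIsCok {X Y Z : C} (k : X ⟶ Y) (q : Y ⟶ Z) (hk : IsKer k q) (hq : IsCok q k) : SES C :=
  ⟨ShortComplex.mk k q hk.w, hk.nonempty_isLimit, hq.nonempty_isColimit⟩

theorem hom_ext {X Y : SES C} {φ ψ : X ⟶ Y} (h : φ.hom.τ₂ = ψ.hom.τ₂) : φ = ψ := by
  have := Y.isKer.mono
  have := X.isCok.epi
  refine ObjectProperty.hom_ext _ (ShortComplex.hom_ext _ _ ?_ h ?_)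
  · rw [← cancel_mono Y.obj.f, φ.hom.comm₁₂, ψ.hom.comm₁₂, h]
  · rw [← cancel_epi X.obj.g, ← φ.hom.comm₂₃, ← ψ.hom.comm₂₃, h]

theorem comp_τ₂ {X Y Z : SES C} (φ : X ⟶ Y) (ψ : Y ⟶ Z) :
    (φ ≫ ψ).hom.τ₂ = φ.hom.τ₂ ≫ ψ.hom.τ₂ := rfl

theorem zero_τ₂ {X Y : SES C} : (0 : X ⟶ Y).hom.τ₂ = 0 := rfl

/-- Morphisms of short exact sequences are the compatible morphisms of middle objects. -/
theorem exists_hom {X Y : SES C} (f : X.obj.X₂ ⟶ Y.obj.X₂) (h : X.obj.f ≫ f ≫ Y.obj.g = 0) :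
    ∃ φ : X ⟶ Y, φ.hom.τ₂ = f := by
  obtain ⟨a, ha⟩ := Y.isKer.lift (X.obj.f ≫ f) (by rwa [Category.assoc])
  obtain ⟨b, hb⟩ := X.isCok.desc (f ≫ Y.obj.g) h
  exact ⟨ObjectProperty.homMk ⟨a, f, b, ha, hb.symm⟩, rfl⟩

theorem f_comp_τ₂_comp_g {X Y : SES C} (φ : X ⟶ Y) : X.obj.f ≫ φ.hom.τ₂ ≫ Y.obj.g = 0 := by
  rw [φ.hom.comm₂₃, reassoc_of% X.obj.zero, zero_comp]

/-- The left square of a morphism is a pullback. -/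
def IsLeftCartesian {X Y : SES C} (φ : X ⟶ Y) : Prop :=
  ∀ ⦃T : C⦄ (t : T ⟶ X.obj.X₂), t ≫ φ.hom.τ₂ ≫ Y.obj.g = 0 → t ≫ X.obj.g = 0

/-- The right square of a morphism is a pushout. -/
def IsRightCocartesian {X Y : SES C} (φ : X ⟶ Y) : Prop :=
  ∀ ⦃T : C⦄ (t : Y.obj.X₂ ⟶ T), X.obj.f ≫ φ.hom.τ₂ ≫ t = 0 → Y.obj.f ≫ t = 0

theorem isKer_of_isLeftCartesian {K X Y : SES C} {φ : K ⟶ X} {f : X ⟶ Y}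
    (h : IsKer φ.hom.τ₂ f.hom.τ₂) (hφ : IsLeftCartesian φ) : IsKer φ f where
  w := hom_ext h.w
  mono := ⟨fun _ _ e => hom_ext (h.mono.right_cancellation _ _ (by
    rw [← comp_τ₂, e, comp_τ₂]))⟩
  lift t ht := by
    obtain ⟨s, hs⟩ := h.lift t.hom.τ₂ (by rw [← comp_τ₂, ht, zero_τ₂])
    obtain ⟨σ, rfl⟩ := exists_hom (X := _) (Y := K) s (by
      rw [← Category.assoc]
      exact hφ _ (by rw [Category.assoc, reassoc_of% hs, f_comp_τ₂_comp_g]))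
    exact ⟨σ, hom_ext hs⟩

theorem isCok_of_isRightCocartesian {X Y Q : SES C} {f : X ⟶ Y} {φ : Y ⟶ Q}
    (h : IsCok φ.hom.τ₂ f.hom.τ₂) (hφ : IsRightCocartesian φ) : IsCok φ f where
  w := hom_ext h.w
  epi := ⟨fun _ _ e => hom_ext (h.epi.left_cancellation _ _ (by
    rw [← comp_τ₂, e, comp_τ₂]))⟩
  desc t ht := by
    obtain ⟨s, hs⟩ := h.desc t.hom.τ₂ (by rw [← comp_τ₂, ht, zero_τ₂])
    obtain ⟨σ, rfl⟩ := exists_hom (X := Q) s (hφ _ (by rw [reassoc_of% hs, f_comp_τ₂_comp_g]))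
    exact ⟨σ, hom_ext hs⟩

/-! ### Kernels, cokernels and normal morphisms of short exact sequences. -/

section ZExact

variable [IsZExact C]

/-- Any morphism into the middle object of `X` is the middle part of a morphism to `X` whose left
square is a pullback. -/
theorem exists_isLeftCartesian (X : SES C) {U : C} (u : U ⟶ X.obj.X₂) :
    ∃ (K Q : C) (k : K ⟶ U) (q : U ⟶ Q) (hk : IsKer k q) (hq : IsCok q k)
      (φ : ofIsKerIsCok k q hk hq ⟶ X), φ.hom.τ₂ = u ∧ IsLeftCartesian φ := by
  have h := isKer_kernel_ι (u ≫ X.obj.g)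
  have hc := isCok_cokernel_π (kernel.ι (u ≫ X.obj.g))
  have hk := h.isNormalMono.isKer hc
  obtain ⟨φ, hφ⟩ := exists_hom (X := ofIsKerIsCok _ _ hk hc) (Y := X) u h.w
  refine ⟨_, _, _, _, hk, hc, φ, hφ, fun T t ht => ?_⟩
  obtain ⟨r, rfl⟩ := h.lift t (hφ ▸ ht)
  exact (Category.assoc _ _ _).trans (by rw [hk.w, comp_zero])

/-- Any morphism from the middle object of `X` is the middle part of a morphism from `X` whose
right square is a pushout. -/
theorem exists_isRightCocartesian (X : SES C) {U : C} (u : X.obj.X₂ ⟶ U) :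
    ∃ (K Q : C) (k : K ⟶ U) (q : U ⟶ Q) (hk : IsKer k q) (hq : IsCok q k)
      (φ : X ⟶ ofIsKerIsCok k q hk hq), φ.hom.τ₂ = u ∧ IsRightCocartesian φ := by
  have h := isCok_cokernel_π (X.obj.f ≫ u)
  have hk := isKer_kernel_ι (cokernel.π (X.obj.f ≫ u))
  have hq := h.isNormalEpi.isCok hk
  obtain ⟨φ, hφ⟩ := exists_hom (X := X) (Y := ofIsKerIsCok _ _ hk hq) u
    ((Category.assoc _ _ _).symm.trans h.w)
  refine ⟨_, _, _, _, hk, hq, φ, hφ, fun T t ht => ?_⟩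
  obtain ⟨r, rfl⟩ := h.desc t ((Category.assoc _ _ _).trans (hφ ▸ ht))
  exact (Category.assoc _ _ _).symm.trans (by rw [hk.w, zero_comp])

theorem exists_isKer {X Y : SES C} (f : X ⟶ Y) :
    ∃ (K : SES C) (φ : K ⟶ X), IsKer φ f ∧ IsKer φ.hom.τ₂ f.hom.τ₂ ∧ IsLeftCartesian φ := by
  obtain ⟨_, _, _, _, _, _, φ, hφ, h⟩ := exists_isLeftCartesian X (kernel.ι f.hom.τ₂)
  have h2 : IsKer φ.hom.τ₂ f.hom.τ₂ := hφ ▸ isKer_kernel_ι _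
  exact ⟨_, φ, isKer_of_isLeftCartesian h2 h, h2, h⟩

theorem exists_isCok {X Y : SES C} (f : X ⟶ Y) :
    ∃ (Q : SES C) (φ : Y ⟶ Q), IsCok φ f ∧ IsCok φ.hom.τ₂ f.hom.τ₂ ∧ IsRightCocartesian φ := by
  obtain ⟨_, _, _, _, _, _, φ, hφ, h⟩ := exists_isRightCocartesian Y (cokernel.π f.hom.τ₂)
  have h2 : IsCok φ.hom.τ₂ f.hom.τ₂ := hφ ▸ isCok_cokernel_π _
  exact ⟨_, φ, isCok_of_isRightCocartesian h2 h, h2, h⟩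

open ZeroObject in
instance : IsZExact (SES C) where
  zero := by
    have h : (𝟙 (0 : C)) = 0 := (isZero_zero C).eq_of_src _ _
    have hk : IsKer (0 : (0 : C) ⟶ 0) (0 : (0 : C) ⟶ 0) :=
      ⟨comp_zero, ⟨fun _ _ _ => (isZero_zero C).eq_of_tgt _ _⟩,
        fun _ _ => ⟨0, (isZero_zero C).eq_of_tgt _ _⟩⟩
    have hq : IsCok (0 : (0 : C) ⟶ 0) (0 : (0 : C) ⟶ 0) :=
      ⟨comp_zero, ⟨fun _ _ _ => (isZero_zero C).eq_of_src _ _⟩,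
        fun _ _ => ⟨0, (isZero_zero C).eq_of_src _ _⟩⟩
    exact ⟨ofIsKerIsCok _ _ hk hq, (IsZero.iff_id_eq_zero _).2 (hom_ext h)⟩
  has_limit f := by
    obtain ⟨K, φ, h, -⟩ := exists_isKer f
    exact ⟨⟨_, h.nonempty_isLimit.some⟩⟩
  has_colimit f := by
    obtain ⟨K, φ, h, -⟩ := exists_isCok f
    exact ⟨⟨_, h.nonempty_isColimit.some⟩⟩

/-- The kernel built in `exists_isKer` has both properties, and they transfer along the comparison
with `φ`. Conversely, they make `φ` a kernel of its cokernel. -/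
theorem isNormalMono_iff {X Y : SES C} (φ : X ⟶ Y) :
    IsNormalMono φ ↔ IsNormalMono φ.hom.τ₂ ∧ IsLeftCartesian φ := by
  constructor
  · intro hφ
    obtain ⟨Z, f, hf⟩ := hφ.exists_isKer
    obtain ⟨K, κ, hκ, hκ₂, hc⟩ := exists_isKer f
    obtain ⟨a, rfl⟩ := hκ.lift φ hf.w
    obtain ⟨b, hb⟩ := hf.lift κ hκ.w
    have hmκ := hκ.mono
    have hmκ₂ := hκ₂.mono
    have hm := hf.mono
    have hab : a ≫ b = 𝟙 _ := by
      rw [← cancel_mono (a ≫ κ), Category.assoc, hb, Category.id_comp]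
    have hab₂ : a.hom.τ₂ ≫ b.hom.τ₂ = 𝟙 _ := by rw [← comp_τ₂, hab]; rfl
    refine ⟨IsKer.isNormalMono (q := f.hom.τ₂) ⟨?_, ?_, fun t ht => ?_⟩, fun T t ht => ?_⟩
    · rw [← comp_τ₂, hf.w, zero_τ₂]
    · have : Mono a.hom.τ₂ := mono_of_mono_fac hab₂
      exact mono_comp a.hom.τ₂ κ.hom.τ₂
    · obtain ⟨s, rfl⟩ := hκ₂.lift t ht
      exact ⟨s ≫ b.hom.τ₂, by rw [Category.assoc, ← comp_τ₂, hb]⟩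
    · have h := hc (t ≫ a.hom.τ₂) (by simpa [comp_τ₂] using ht)
      rw [← Category.comp_id t, ← hab₂, Category.assoc, Category.assoc, b.hom.comm₂₃,
        ← Category.assoc, ← Category.assoc, h, zero_comp]
  · rintro ⟨h, hc⟩
    obtain ⟨Q, ψ, -, hψ, -⟩ := exists_isCok φ
    exact (isKer_of_isLeftCartesian (h.isKer hψ) hc).isNormalMono

theorem isNormalEpi_iff {X Y : SES C} (φ : X ⟶ Y) :
    IsNormalEpi φ ↔ IsNormalEpi φ.hom.τ₂ ∧ IsRightCocartesian φ := by
  constructor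
  · intro hφ
    obtain ⟨Z, f, hf⟩ := hφ.exists_isCok
    obtain ⟨Q, κ, hκ, hκ₂, hc⟩ := exists_isCok f
    obtain ⟨a, rfl⟩ := hκ.desc φ hf.w
    obtain ⟨b, hb⟩ := hf.desc κ hκ.w
    have heκ := hκ.epi
    have heκ₂ := hκ₂.epi
    have he := hf.epi
    have hba : b ≫ a = 𝟙 _ := by
      rw [← cancel_epi (κ ≫ a), ← Category.assoc, hb, Category.comp_id]
    have hba₂ : b.hom.τ₂ ≫ a.hom.τ₂ = 𝟙 _ := by rw [← comp_τ₂, hba]; rfl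
    refine ⟨IsCok.isNormalEpi (k := f.hom.τ₂) ⟨?_, ?_, fun t ht => ?_⟩, fun T t ht => ?_⟩
    · rw [← comp_τ₂, hf.w, zero_τ₂]
    · have : Epi a.hom.τ₂ := epi_of_epi_fac hba₂
      exact epi_comp κ.hom.τ₂ a.hom.τ₂
    · obtain ⟨s, rfl⟩ := hκ₂.desc t ht
      exact ⟨b.hom.τ₂ ≫ s, by rw [← Category.assoc, ← comp_τ₂, hb]⟩
    · have h := hc (a.hom.τ₂ ≫ t) (by simpa [comp_τ₂] using ht)
      rw [← Category.id_comp t, ← hba₂, Category.assoc, ← Category.assoc, ← b.hom.comm₁₂,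
        Category.assoc, h, comp_zero]
  · rintro ⟨h, hc⟩
    obtain ⟨Q, ψ, -, hψ, -⟩ := exists_isKer φ
    exact (isCok_of_isRightCocartesian (h.isCok hψ) hc).isNormalEpi

/-- A morphism that kills the kernel of `e` and the image of `Y.obj.f` extends to the quotient
of the codomain of `e`. -/
theorem exists_desc {Y Z : SES C} {e : Y ⟶ Z} (he : IsNormalEpi e) {T : C} (y : Y.obj.X₂ ⟶ T)
    (hy : Y.obj.f ≫ y = 0) (hey : ∀ {S : C} (s : S ⟶ Y.obj.X₂), s ≫ e.hom.τ₂ = 0 → s ≫ y = 0) :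
    ∃ r, e.hom.τ₂ ≫ Z.obj.g ≫ r = y := by
  rw [isNormalEpi_iff] at he
  obtain ⟨y', rfl⟩ := he.1.exists_desc y hey
  obtain ⟨y'', rfl⟩ := Z.isCok.desc y' (he.2 _ hy)
  exact ⟨y'', rfl⟩

/-- Composites of normal epimorphisms need not be normal in general. This one is the quotient by the
join of `Y.obj.f` and the kernel of `e.hom.τ₂`, by the pushout property of the right square. -/
theorem isNormalEpi_τ₂_comp_g {Y Z : SES C} {e : Y ⟶ Z} (he : IsNormalEpi e) :
    IsNormalEpi (e.hom.τ₂ ≫ Z.obj.g) := by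
  have h := ((isNormalEpi_iff e).1 he).1.epi
  have h' := Z.isCok.epi
  refine IsCok.isNormalEpi (k := kernel.ι (e.hom.τ₂ ≫ Z.obj.g))
    ⟨kernel.condition _, epi_comp _ _, fun t ht => ?_⟩
  have ht' : ∀ {S : C} (s : S ⟶ Y.obj.X₂), s ≫ e.hom.τ₂ ≫ Z.obj.g = 0 → s ≫ t = 0 :=
    fun s hs => by rw [← kernel.lift_ι _ s hs, Category.assoc, ht, comp_zero]
  obtain ⟨r, hr⟩ := exists_desc he t (ht' _ (f_comp_τ₂_comp_g e))
    (fun s hs => ht' s (by rw [reassoc_of% hs, zero_comp]))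
  exact ⟨r, by rw [Category.assoc, hr]⟩

/-- Extracts the distributivity inclusion from a normal factorization: the pullback square of `ν`
puts `j ≫ π.hom.τ₂` into the first term of `I`, and the pushout square of `π` makes the descended
`s` vanish there. -/
theorem comp_eq_zero_of_isNormalMap {X Z : SES C} {f : X ⟶ Z} (hf : IsNormalMap f) {S J : C}
    {s : X.obj.X₂ ⟶ S} {j : J ⟶ X.obj.X₂} (hs : X.obj.f ≫ s = 0)
    (hfs : ∀ {T : C} (t : T ⟶ X.obj.X₂), t ≫ f.hom.τ₂ = 0 → t ≫ s = 0)
    (hj : j ≫ f.hom.τ₂ ≫ Z.obj.g = 0) : j ≫ s = 0 := by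
  obtain ⟨I, π, ν, hπ, hν, rfl⟩ := hf
  rw [isNormalEpi_iff] at hπ
  rw [isNormalMono_iff] at hν
  simp only [comp_τ₂, Category.assoc] at hfs hj
  obtain ⟨s', rfl⟩ := hπ.1.exists_desc s
    (fun t ht => hfs t (by rw [← Category.assoc, ht, zero_comp]))
  obtain ⟨r, hr⟩ := I.isKer.lift (j ≫ π.hom.τ₂) (hν.2 _ (by rwa [Category.assoc]))
  rw [← Category.assoc, ← hr, Category.assoc, hπ.2 s' hs, comp_zero]

end ZExact

/-! ### Antinormal maps of short exact sequences and distributivity. -/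

theorem isNormalMap_comp [IsDiExact C] {X Y Z : SES C} {m : X ⟶ Y} {e : Y ⟶ Z}
    (hm : IsNormalMono m) (he : IsNormalEpi e)
    (H : ∀ ⦃S J : C⦄ (s : X.obj.X₂ ⟶ S) (j : J ⟶ X.obj.X₂), X.obj.f ≫ s = 0 →
      (∀ ⦃T : C⦄ (t : T ⟶ X.obj.X₂), t ≫ m.hom.τ₂ ≫ e.hom.τ₂ = 0 → t ≫ s = 0) →
      j ≫ m.hom.τ₂ ≫ e.hom.τ₂ ≫ Z.obj.g = 0 → j ≫ s = 0) :
    IsNormalMap (m ≫ e) := by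
  have hm₂ := ((isNormalMono_iff m).1 hm).1
  obtain ⟨I₂, p, n, hp, hn, hpn⟩ := IsDiExact.isNormalMap_of_isAntinormalMap
    (m.hom.τ₂ ≫ e.hom.τ₂) ⟨_, _, _, hm₂, ((isNormalEpi_iff e).1 he).1, rfl⟩
  obtain ⟨J₂, p', n', hp', hn', hpn'⟩ := IsDiExact.isNormalMap_of_isAntinormalMap
    (m.hom.τ₂ ≫ e.hom.τ₂ ≫ Z.obj.g) ⟨_, _, _, hm₂, isNormalEpi_τ₂_comp_g he, rfl⟩
  have hpn'' : p ≫ n ≫ Z.obj.g = p' ≫ n' := by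
    rw [hpn', reassoc_of% hpn]
  -- Normality of `ν` forces this sequence on the image `I₂`; what remains is that the right square
  -- of `π` is a pushout.
  obtain ⟨I₁, I₃, i, q, hi, hq, ν, hν₂, hν⟩ := exists_isLeftCartesian Z n
  have hIν : ∀ ⦃T : C⦄ (t : T ⟶ I₂), t ≫ n ≫ Z.obj.g = 0 → t ≫ q = 0 :=
    fun T t ht => hν t (hν₂ ▸ ht)
  have hνI : i ≫ n ≫ Z.obj.g = 0 := hν₂ ▸ f_comp_τ₂_comp_g ν
  obtain ⟨π, hπ₂⟩ := exists_hom (X := X) (Y := ofIsKerIsCok i q hi hq) p (by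
    rw [← Category.assoc]
    refine hIν _ ?_
    rw [Category.assoc, reassoc_of% hpn, ← reassoc_of% m.hom.comm₁₂, f_comp_τ₂_comp_g, comp_zero])
  have hep := hp.epi
  have hmn' := hn'.mono
  refine ⟨_, π, ν, (isNormalEpi_iff π).2 ⟨hπ₂ ▸ hp, fun T t ht => ?_⟩,
    (isNormalMono_iff ν).2 ⟨hν₂ ▸ hn, hν⟩, hom_ext ?_⟩
  · rw [hπ₂] at ht
    change i ≫ t = 0
    obtain ⟨b, rfl⟩ := hp.exists_desc p' (fun x hx => by
      rw [← cancel_mono n', Category.assoc, ← hpn'', reassoc_of% hx, zero_comp, zero_comp])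
    -- `H` says that `p ≫ t` kills the kernel of `p'`, so `t` factors through `b`, which kills `i`.
    obtain ⟨t', ht'⟩ := hp'.exists_desc (p ≫ t) (fun x hx =>
      H (p ≫ t) x ht
        (fun _ a ha => by
          have hmn := hn.mono
          have hap : a ≫ p = 0 := by
            rw [← cancel_mono n, Category.assoc, hpn, ha, zero_comp]
          rw [reassoc_of% hap, zero_comp])
        (by rw [← hpn', ← Category.assoc, hx, zero_comp]))
    rw [Category.assoc, cancel_epi] at ht' hpn''
    have hib : i ≫ b = 0 := by
      rw [← cancel_mono n', Category.assoc, ← hpn'', hνI, zero_comp]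
    rw [← ht', reassoc_of% hib, zero_comp]
  · rw [comp_τ₂, comp_τ₂, hπ₂, hν₂, hpn]

theorem meetLeJoin [IsZExact C] [IsDiExact (SES C)] : MeetLeJoin C := by
  intro A U V W S J u v w s j hu hv hw hsv hsw hj
  have hq := isCok_cokernel_π v
  have hk := hv.isKer hq
  have hc := isCok_cokernel_π w
  have hkc := hw.isKer hc
  -- Realize U, V, W by an antinormal map through V → A → A/V: the pullback makes `X₁` the meet U ∧
  -- V, and the pushout makes `Z₃` the quotient by V ∨ W.
  obtain ⟨X₁, X₃, x, _, hx, hx', m, hm₂, hm⟩ :=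
    exists_isLeftCartesian (ofIsKerIsCok _ _ hk hq) u
  obtain ⟨Z₁, Z₃, _, z, hz, hz', e, he₂, he⟩ :=
    exists_isRightCocartesian (ofIsKerIsCok _ _ hk hq) (cokernel.π w)
  have hf₂ : (m ≫ e).hom.τ₂ = u ≫ cokernel.π w := by rw [comp_τ₂, hm₂, he₂]
  have hf : IsNormalMap (m ≫ e) := IsDiExact.isNormalMap_of_isAntinormalMap _
    ⟨_, m, e, (isNormalMono_iff m).2 ⟨hm₂ ▸ hu, hm⟩,
      (isNormalEpi_iff e).2 ⟨he₂ ▸ hc.isNormalEpi, he⟩, rfl⟩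
  refine comp_eq_zero_of_isNormalMap hf (s := s) (j := j) ?_ (fun t ht => ?_) ?_
  · exact hsv x m.hom.τ₁ (hm₂ ▸ m.hom.comm₁₂.symm)
  · obtain ⟨r, hr⟩ := hkc.lift (t ≫ u) (by rw [Category.assoc, ← hf₂, ht])
    exact hsw t r hr.symm
  · have h := hj (cokernel.π w ≫ z) (he₂ ▸ f_comp_τ₂_comp_g e) (by rw [reassoc_of% hc.w, zero_comp])
    rw [hf₂, Category.assoc]
    exact h

theorem isDiExact [IsDiExact C] (H : MeetLeJoin C) : IsDiExact (SES C) where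
  isNormalMap_of_isAntinormalMap := by
    rintro X Z _ ⟨Y, m, e, hm, he, rfl⟩
    have hm' := (isNormalMono_iff m).1 hm
    refine isNormalMap_comp hm he (fun S J s j hs hes hj => ?_)
    -- The three normal subobjects of `Y.obj.X₂` attached to the antinormal map.
    refine H m.hom.τ₂ Y.obj.f (kernel.ι e.hom.τ₂) s j hm'.1 Y.isKer.isNormalMono
      (isNormalMono_kernel_ι _) (fun T t r htr => ?_) (fun T t r htr => ?_) (fun T y hy hwy => ?_)
    · obtain ⟨a, rfl⟩ := X.isKer.lift t (hm'.2 t (by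
        rw [reassoc_of% htr, Y.obj.zero, comp_zero]))
      rw [Category.assoc, hs, comp_zero]
    · exact hes t (by rw [reassoc_of% htr, kernel.condition, comp_zero])
    · obtain ⟨r, rfl⟩ := exists_desc he y hy (fun a ha => by
        rw [← kernel.lift_ι _ a ha, Category.assoc, hwy, comp_zero])
      simp only [← Category.assoc] at hj ⊢
      rw [hj, zero_comp]

end SES

end ZExact

theorem mainTheorem1 (C : Type u) [Category.{v} C] [HasZeroMorphisms C]
    [ZExact.IsDiExact C] :
    ZExact.IsDiExact (ZExact.SES C) ↔ ∀ X : C, ZExact.IsDistributive (ZExact.NSub X) :=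
  ⟨fun _ => ZExact.SES.meetLeJoin.isDistributive,
    fun h => ZExact.SES.isDiExact (ZExact.meetLeJoin_of_isDistributive h)⟩
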